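/- There are universal constants $K\in\mathbb N$ and $c>0$ such that the following holds for all integers $r\ge 1$, $n\ge 1$ and $k\ge 2$ (in particular for $k=2$). In the coordinator model there are $k$ sites and a coordinator. The $n$ constraints of a $2$-dimensional linear program $$\min_{x\in\mathbb R^2}\ \langle c_0,x\rangle\quad\text{subject to}\quad \langle a^j,x\rangle\le b^j\ \ (j=1,\dots,n)$$ are partitioned arbitrarily among the $k$ sites (some sites may receive none), and the objective vector $c_0$ is known to all parties. In each round the coordinator sends a bit string to each site (depending on the replies received so far), and then each site replies with a bit string (depending on its own constraints and on the messages it has received so far). After $r$ rounds the coordinator outputs a point of $\mathbb R^2$. All parties may use shared random coins and unlimited local computation. The communication of an execution is the total number of bits in all messages in both directions. Suppose that an $r$-round randomized algorithm in this model has the following property: for every $2$-dimensional linear program with $n$ constraints that has an optimal solution and in which all entries of $c_0$, $a^j$, $b^j$ are integers of absolute value at most $n^K$ (so every number has $O(\log n)$ bits), and for every partition of its constraints among the $k$ sites, the output is an optimal solution with probability at least $2/3$. Then the worst-case communication of the algorithm is at least $$c\cdot\frac{n^{1/(2r)}}{r^2},$$ that is, on some such linear program, some partition and some outcome of the coins,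 at least this many bits are sent. In short, $\Omega\!\left(n^{1/(2r)}/r^2\right)$ bits of communication are necessary. -/

import Mathlib

open MeasureTheory

/-- A linear constraint `∑ i, a i * x i ≤ b` in `d` variables with integer data, as the pair
`(a, b)`. -/
abbrev LinearConstraint (d : ℕ) : Type := (Fin d → ℤ) × ℤ

/-- The `d`-dimensional linear program with `n` constraints
`min ∑ i, obj i * x i` over `x ∈ ℝ^d` subject to
`∑ i, (con j).1 i * x i ≤ (con j).2` for all `j`. -/
structure LinearProgram (d n : ℕ) where
  obj : Fin d → ℤ
  con : Fin n → LinearConstraint d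

namespace LinearProgram

variable {d n : ℕ}

/-- The value of the objective at the point `x`. -/
def value (P : LinearProgram d n) (x : Fin d → ℝ) : ℝ := ∑ i, (P.obj i : ℝ) * x i

/-- The point `x` satisfies all the constraints. -/
def Feasible (P : LinearProgram d n) (x : Fin d → ℝ) : Prop :=
  ∀ j, ∑ i, ((P.con j).1 i : ℝ) * x i ≤ ((P.con j).2 : ℝ)

/-- The point `x` is an optimal solution. -/
def IsOptimal (P : LinearProgram d n) (x : Fin d → ℝ) : Prop :=
  P.Feasible x ∧ ∀ y, P.Feasible y → P.value x ≤ P.value y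

/-- The linear program has an optimal solution (it is feasible and bounded). -/
def Solvable (P : LinearProgram d n) : Prop := ∃ x, P.IsOptimal x

/-- All the numbers in the linear program are at most `M` in absolute value. -/
def EntriesBounded (P : LinearProgram d n) (M : ℤ) : Prop :=
  (∀ i, |P.obj i| ≤ M) ∧ ∀ j, (∀ i, |(P.con j).1 i| ≤ M) ∧ |(P.con j).2| ≤ M

/-- When constraint `j` is placed on site `owner j`, this is the input of site `s`: the
constraints placed on `s` (with their indices), and nothing about the other ones. -/
def siteInput {k : ℕ} (P : LinearProgram d n) (owner : Fin n → Fin k) (s : Fin k) :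
    Fin n → Option (LinearConstraint d) :=
  fun j => if owner j = s then some (P.con j) else none

end LinearProgram

/-- Messages are bit strings. -/
abbrev Message : Type := List Bool

/-- A randomized algorithm in the coordinator model with `k` sites. Here `Ω` is the space of coin
outcomes, `Z` the type of the input known to everybody, `X` the type of the private inputs of the
sites, and `O` the type of the outputs. All coins are visible to all parties, which includes
private coins as a special case. Local computation is unrestricted.

In each round the coordinator sends to every site a message that depends on the coins, the public
input and all replies of the earlier rounds; then every site replies with a message that depends
on the coins, the public input, its own input, and all messages that this site has received so
far, the one of the current round included. At the end the coordinator computes the output from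
the coins, the public input and all replies. (What a party has sent itself is determined by these
data.) The lists are in the order of the rounds. -/
structure CoordinatorProtocol (k : ℕ) (Ω Z X O : Type*) where
  query : Ω → Z → List (Fin k → Message) → Fin k → Message
  reply : Fin k → Ω → Z → X → List Message → Message
  output : Ω → Z → List (Fin k → Message) → O

namespace CoordinatorProtocol

variable {k : ℕ} {Ω Z X O : Type*}

/-- The messages of the first `r` rounds: for each round the messages from the coordinator to the
sites, and the replies of the sites. -/
def transcript (π : CoordinatorProtocol k Ω Z X O) (ω : Ω) (z : Z) (x : Fin k → X) :
    ℕ → List ((Fin k → Message) × (Fin k → Message))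
  | 0 => []
  | r + 1 =>
    let past := π.transcript ω z x r
    let q := π.query ω z (past.map Prod.snd)
    past ++ [(q, fun s => π.reply s ω z (x s) (past.map (fun m => m.1 s) ++ [q s]))]

/-- The output of the coordinator after `r` rounds. -/
def result (π : CoordinatorProtocol k Ω Z X O) (r : ℕ) (ω : Ω) (z : Z) (x : Fin k → X) : O :=
  π.output ω z ((π.transcript ω z x r).map Prod.snd)

/-- The total number of bits sent in `r` rounds, by the coordinator and by all the sites. -/
def communication (π : CoordinatorProtocol k Ω Z X O) (r : ℕ) (ω : Ω) (z : Z) (x : Fin k → X) :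
    ℕ :=
  ((π.transcript ω z x r).map
    (fun m => ∑ s : Fin k, ((m.1 s).length + (m.2 s).length))).sum

end CoordinatorProtocol

/-- Randomized algorithms in the coordinator model with `k` sites for `d`-dimensional linear
programs with `n` constraints. The objective is known to the coordinator and to all sites. -/
abbrev LPCoordinatorProtocol (d n k : ℕ) (Ω : Type*) :=
  CoordinatorProtocol k Ω (Fin d → ℤ) (Fin n → Option (LinearConstraint d)) (Fin d → ℝ)

namespace LPCoordinatorProtocol

variable {d n k : ℕ} {Ω : Type*}

/-- The output after `r` rounds on the program `P` with its constraints distributed by `owner`. -/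
def lpResult (π : LPCoordinatorProtocol d n k Ω) (r : ℕ) (P : LinearProgram d n)
    (owner : Fin n → Fin k) (ω : Ω) : Fin d → ℝ :=
  π.result r ω P.obj (P.siteInput owner)

/-- The total communication, in bits, of `r` rounds on the program `P` with its constraints
distributed by `owner`. -/
def lpCommunication (π : LPCoordinatorProtocol d n k Ω) (r : ℕ) (P : LinearProgram d n)
    (owner : Fin n → Fin k) (ω : Ω) : ℕ :=
  π.communication r ω P.obj (P.siteInput owner)

/-- With the coins `ω ~ μ`, for every linear program with entries at most `M` in absolute value
that has an optimal solution, and for every distribution of its constraints among the sites, the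
output after `r` rounds is an optimal solution with probability at least `p`. -/
def SolvesWithProb [MeasurableSpace Ω] (π : LPCoordinatorProtocol d n k Ω) (r : ℕ)
    (μ : Measure Ω) (M : ℤ) (p : ℝ) : Prop :=
  ∀ P : LinearProgram d n, P.Solvable → P.EntriesBounded M → ∀ owner : Fin n → Fin k,
    MeasurableSet {ω | P.IsOptimal (π.lpResult r P owner ω)} ∧
      p ≤ μ.real {ω | P.IsOptimal (π.lpResult r P owner ω)}

end LPCoordinatorProtocol

/-! The proof is round elimination for a recursively defined two-party game, together with a
realization of that game by planar linear programs.

At level 0 the answer is a uniform bit that the guesser does not see. At each further level the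
speaker holds `N` independent copies of the previous game in the role of its second party, and the
other party holds an index `i` and an input for the first party; only copy `i` counts. A message
from `M` chosen without knowing `i` says on average only about `log |M| / N` about copy `i`.
Dropping it therefore raises the success probability by at most `lam + (log |M| + 1) / (lam * N)`
for any `lam` in `(0, 1]` (`HardGame.step`, from `exists_truncation` and `sum_test_le`).
Conditioning on a message is expressed by unnormalized weights that are at most uniform.

Geometrically, each input is a family of lines. One upper envelope and the negative of the other
touch in a single point, and the parity of its abscissa is the answer. To compose, the families of
the `N` copies are moved to disjoint blocks and tilted along a steep convex parabola, so that over
block `i` only family `i` reaches the envelope. The other party knows `i`, moves its lines to that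
block and subtracts the tilt (`TouchingLines.step`). The number of lines grows by a factor of at
most `N` per level and the coefficients remain polynomial in `n`.

Placing the two families on two sites, `r` rounds become `2 * r` alternating messages
(`twoPartyComputable_truncate`, `exists_twoPartyComputable`). With `N` about `n ^ (1 / (2 r)) / 2`
and `lam` of order `1 / r`, success probability `2/3` forces `N` to be `O(r ^ 2 * (L + 1))`, where
`L` bounds the communication. -/

/-! ### Two-party games with weighted inputs -/

/-- A Boolean function of two inputs can be computed by a protocol in which the owner of the first
input speaks first, the two parties alternate, `t` messages from `M` are sent in total, and the
output is determined by the messages. -/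
def TwoPartyComputable (M : Type) : ℕ → ∀ {A B : Type}, (A → B → Bool) → Prop
  | 0, _, _, F => ∃ o, ∀ a b, F a b = o
  | t + 1, A, B, F => ∃ (f : A → M) (G : M → B → A → Bool),
      (∀ m, TwoPartyComputable M t (G m)) ∧ ∀ a b, F a b = G (f a) b a

open Classical in
/-- The image under `p` of the nonnegative weight `α` is at most `κ` times the uniform
probability. -/
def SubUniform {A X : Type} [Fintype A] [Fintype X] (κ : ℝ) (α : A → ℝ) (p : A → X) : Prop :=
  (∀ a, 0 ≤ α a) ∧ ∀ x, (∑ a, if p a = x then α a else 0) ≤ κ / Fintype.card X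

/-- With independent inputs that are distributed at most uniformly, a protocol with `t` messages
from `M` computes `ans` correctly with probability at most `ε`. The parties may know more than
their inputs `p a` and `q b`. -/
def HardGame (M : Type) (t : ℕ) (ε : ℝ) {S T : Type} [Fintype S] [Fintype T]
    (ans : S → T → Bool) : Prop :=
  ∀ (A B : Type) [Fintype A] [Fintype B] (p : A → S) (q : B → T) (α : A → ℝ) (β : B → ℝ),
    SubUniform 1 α p → SubUniform 1 β q → ∀ F : A → B → Bool, TwoPartyComputable M t F →
      ∑ a, ∑ b, α a * β b * (if F a b = ans (p a) (q b) then 1 else 0) ≤ ε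

namespace SubUniform

variable {A X : Type} [Fintype A] [Fintype X] {κ : ℝ} {α : A → ℝ} {p : A → X}

theorem sum_mul_le (h : SubUniform κ α p) {g : X → ℝ} (hg : ∀ x, 0 ≤ g x) :
    ∑ a, α a * g (p a) ≤ κ / Fintype.card X * ∑ x, g x := by
  classical
  calc ∑ a, α a * g (p a) = ∑ x, (∑ a, if p a = x then α a else 0) * g x := by
        simp_rw [Finset.sum_mul]
        rw [Finset.sum_comm]
        refine Finset.sum_congr rfl fun a _ => ?_
        simp [ite_mul]
    _ ≤ ∑ x, κ / Fintype.card X * g x := by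
        refine Finset.sum_le_sum fun x _ => mul_le_mul_of_nonneg_right ?_ (hg x)
        convert h.2 x
    _ = _ := by rw [Finset.mul_sum]

theorem sum_le [Nonempty X] (h : SubUniform κ α p) : ∑ a, α a ≤ κ := by
  have h1 := h.sum_mul_le (g := fun _ => 1) (fun _ => zero_le_one)
  have hX : (Fintype.card X : ℝ) ≠ 0 := by exact_mod_cast Fintype.card_ne_zero
  simpa [hX] using h1

theorem mono (h : SubUniform κ α p) {α' : A → ℝ} (h0 : ∀ a, 0 ≤ α' a) (hle : ∀ a, α' a ≤ α a) :
    SubUniform κ α' p := by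
  classical
  refine ⟨h0, fun x => le_trans (Finset.sum_le_sum fun a _ => ?_) (h.2 x)⟩
  split_ifs
  · exact hle a
  · exact le_rfl

theorem smul (h : SubUniform κ α p) {c : ℝ} (hc : 0 ≤ c) :
    SubUniform (c * κ) (fun a => c * α a) p := by
  classical
  refine ⟨fun a => mul_nonneg hc (h.1 a), fun x => ?_⟩
  have := mul_le_mul_of_nonneg_left (h.2 x) hc
  rw [Finset.mul_sum] at this
  simpa [mul_div_assoc, mul_ite] using this

theorem eq_zero_of_nonpos [Nonempty X] (h : SubUniform κ α p) (hκ : κ ≤ 0) (a : A) : α a = 0 := by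
  have h1 := (Finset.single_le_sum (fun a _ => h.1 a) (Finset.mem_univ a)).trans (h.sum_le.trans hκ)
  exact le_antisymm h1 (h.1 a)

end SubUniform

/-- The success probability scales with the total weights. -/
theorem HardGame.sum_le {M : Type} {t : ℕ} {ε : ℝ} {S T : Type} [Fintype S] [Fintype T]
    [Nonempty S] [Nonempty T] {ans : S → T → Bool} (h : HardGame M t ε ans)
    {A B : Type} [Fintype A] [Fintype B] {p : A → S} {q : B → T} {α : A → ℝ} {β : B → ℝ}
    {κ κ' : ℝ} (hκ : 0 ≤ κ) (hκ' : 0 ≤ κ') (hα : SubUniform κ α p) (hβ : SubUniform κ' β q)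
    {F : A → B → Bool} (hF : TwoPartyComputable M t F) :
    ∑ a, ∑ b, α a * β b * (if F a b = ans (p a) (q b) then 1 else 0) ≤ κ * κ' * ε := by
  -- Weights of total bound zero vanish and cannot be normalized, so they are treated apart.
  rcases hκ.eq_or_lt with rfl | hκ
  · simp [hα.eq_zero_of_nonpos le_rfl]
  rcases hκ'.eq_or_lt with rfl | hκ'
  · simp [hβ.eq_zero_of_nonpos le_rfl]
  have h1 := hα.smul (inv_nonneg.2 hκ.le)
  have h2 := hβ.smul (inv_nonneg.2 hκ'.le)
  rw [inv_mul_cancel₀ hκ.ne'] at h1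
  rw [inv_mul_cancel₀ hκ'.ne'] at h2
  have h3 := mul_le_mul_of_nonneg_left (h A B p q _ _ h1 h2 F hF) (mul_pos hκ hκ').le
  refine le_trans (le_of_eq ?_) h3
  simp_rw [Finset.mul_sum]
  refine Finset.sum_congr rfl fun a _ => Finset.sum_congr rfl fun b _ => ?_
  field_simp

/-- Guessing a uniform bit. -/
theorem hardGame_bit (M : Type) : HardGame M 0 (1 / 2) (fun (_ : Unit) (b : Bool) => b) := by
  classical
  rintro A B _ _ p q α β hα hβ F ⟨o, ho⟩
  have h1 := hβ.sum_mul_le (g := fun x => if o = x then 1 else 0) (fun x => by split_ifs <;> simp)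
  have h2 := hα.sum_le
  simp only [Fintype.card_bool, Finset.sum_ite_eq, Finset.mem_univ, if_true] at h1
  calc ∑ a, ∑ b, α a * β b * (if F a b = q b then 1 else 0)
      = (∑ a, α a) * ∑ b, β b * (if o = q b then 1 else 0) := by
        rw [Finset.sum_mul]
        simp_rw [Finset.mul_sum, ho, mul_assoc]
    _ ≤ 1 * (1 / 2) := by
        refine mul_le_mul h2 (by simpa using h1)
          (Finset.sum_nonneg fun b _ => mul_nonneg (hβ.1 b) (by split_ifs <;> simp)) zero_le_one
    _ = 1 / 2 := one_mul _

/-! ### Deviation of weights from uniformity -/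

/-- A weight can be decreased to one with an image of at most its total times the uniform
probability, and the loss is seen by a test function. -/
theorem exists_truncation {A X : Type} [Fintype A] [Fintype X] [Nonempty X] {α : A → ℝ}
    (hα : ∀ a, 0 ≤ α a) (g : A → X) :
    ∃ (α' : A → ℝ) (φ : X → ℝ), (∀ a, α' a ≤ α a) ∧ SubUniform (∑ a, α a) α' g ∧
      (∀ x, 0 ≤ φ x ∧ φ x ≤ 1) ∧
      ∑ a, (α a - α' a) = ∑ a, α a * (φ (g a) - (∑ x, φ x) / Fintype.card X) := by
  classical
  set w := ∑ a, α a with hw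
  set u : ℝ := w / Fintype.card X with hu
  have hw0 : 0 ≤ w := Finset.sum_nonneg fun a _ => hα a
  have hu0 : 0 ≤ u := by positivity
  set ν : X → ℝ := fun x => ∑ a, if g a = x then α a else 0 with hν
  have hν0 : ∀ x, 0 ≤ ν x := fun x => Finset.sum_nonneg fun a _ => by
    split_ifs
    exacts [hα a, le_rfl]
  have hfib : ∀ f : X → ℝ, ∑ a, α a * f (g a) = ∑ x, ν x * f x := by
    intro f
    simp_rw [hν, Finset.sum_mul]
    rw [Finset.sum_comm]
    refine Finset.sum_congr rfl fun a _ => ?_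
    simp [ite_mul]
  set θ : X → ℝ := fun x => if u < ν x then u / ν x else 1 with hθ
  have hθ0 : ∀ x, 0 ≤ θ x := fun x => by
    simp only [hθ]; split_ifs
    exacts [div_nonneg hu0 (hν0 x), zero_le_one]
  have hθ1 : ∀ x, θ x ≤ 1 := fun x => by
    simp only [hθ]; split_ifs with h
    exacts [div_le_one_of_le₀ h.le (hν0 x), le_rfl]
  -- Multiplying by `θ` caps the image density `ν` at the uniform level `u`. The mass removed is the
  -- sum of `ν x - u` over the set where `u < ν x`, which is the excess of the `ν`-mass of this set
  -- over `w` times its uniform probability. Hence the indicator of this set is the test function.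
  refine ⟨fun a => α a * θ (g a), fun x => if u < ν x then 1 else 0,
    fun a => mul_le_of_le_one_right (hα a) (hθ1 _),
    ⟨fun a => mul_nonneg (hα a) (hθ0 _), fun x => ?_⟩, fun x => by dsimp only; split_ifs <;> simp, ?_⟩
  · calc (∑ a, if g a = x then α a * θ (g a) else 0)
        = ν x * θ x := by
          simp only [hν, Finset.sum_mul, ite_mul, zero_mul]
          refine Finset.sum_congr rfl fun a _ => ?_
          split_ifs with h
          · rw [h]
          · rfl
      _ ≤ u := by
          simp only [hθ]; split_ifs with h
          · rw [mul_div_cancel₀ _ (hu0.trans_lt h).ne']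
          · simpa using h
  · have e1 : ∑ a, (α a - α a * θ (g a)) = ∑ x, ν x * (1 - θ x) := by
      rw [← hfib]
      exact Finset.sum_congr rfl fun a _ => by ring
    have e2 := hfib (fun x => if u < ν x then 1 else 0)
    have e3 : w * ((∑ x, if u < ν x then (1 : ℝ) else 0) / Fintype.card X) =
        ∑ x, u * if u < ν x then 1 else 0 := by
      rw [← Finset.mul_sum, hu]; ring
    have e4 : ∀ c : ℝ, ∑ a, α a * ((if u < ν (g a) then 1 else 0) - c) =
        ∑ a, (α a * if u < ν (g a) then 1 else 0) - w * c := fun c => by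
      simp_rw [mul_sub]
      rw [Finset.sum_sub_distrib, ← Finset.sum_mul]
    rw [e1, e4, e2, e3, ← Finset.sum_sub_distrib]
    refine Finset.sum_congr rfl ?_
    intro x _
    simp only [hθ]; split_ifs with h
    · rw [mul_sub, mul_div_cancel₀ _ (hu0.trans_lt h).ne']; ring
    · simp

/-- The exponential moment of a centred function with values in `[0, 1]`. -/
theorem sum_exp_centered_le {X : Type} [Fintype X] [Nonempty X] {φ : X → ℝ}
    (hφ : ∀ x, 0 ≤ φ x ∧ φ x ≤ 1) {lam : ℝ} (h0 : 0 ≤ lam) (h1 : lam ≤ 1) :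
    ∑ x, Real.exp (lam * (φ x - (∑ x, φ x) / Fintype.card X)) ≤
      Fintype.card X * Real.exp (lam ^ 2) := by
  have hX : (0 : ℝ) < Fintype.card X := by exact_mod_cast Fintype.card_pos
  set m := (∑ x, φ x) / Fintype.card X with hm
  have hm0 : 0 ≤ m := div_nonneg (Finset.sum_nonneg fun x _ => (hφ x).1) hX.le
  have hm1 : m ≤ 1 := by
    rw [hm, div_le_one hX]
    calc ∑ x, φ x ≤ ∑ _x : X, (1 : ℝ) := Finset.sum_le_sum fun x _ => (hφ x).2
      _ = _ := by simp
  -- The linear term sums to zero because `m` is the mean of `φ`.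
  have hx : ∀ x, Real.exp (lam * (φ x - m)) ≤ 1 + lam * (φ x - m) + lam ^ 2 := by
    intro x
    have ha : |φ x - m| ≤ 1 := abs_le.2 ⟨by linarith [(hφ x).1], by linarith [(hφ x).2]⟩
    have hz : |lam * (φ x - m)| ≤ 1 := by
      rw [abs_mul, abs_of_nonneg h0]
      exact mul_le_one₀ h1 (abs_nonneg _) ha
    have h2 := (abs_le.1 (Real.abs_exp_sub_one_sub_id_le hz)).2
    have h3 : (lam * (φ x - m)) ^ 2 ≤ lam ^ 2 := by
      rw [mul_pow]
      exact mul_le_of_le_one_right (sq_nonneg _) ((sq_le_one_iff_abs_le_one _).2 ha)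
    linarith
  calc ∑ x, Real.exp (lam * (φ x - m)) ≤ ∑ x, (1 + lam * (φ x - m) + lam ^ 2) :=
        Finset.sum_le_sum fun x _ => hx x
    _ = Fintype.card X * (1 + lam ^ 2) := by
        have : ∑ x, φ x = Fintype.card X * m := by rw [hm]; field_simp
        simp only [Finset.sum_add_distrib, ← Finset.mul_sum, Finset.sum_sub_distrib, this]
        simp
        ring
    _ ≤ _ := by
        gcongr
        linarith [Real.add_one_le_exp (lam ^ 2)]

/-- A weight on a power of `X` of at most the uniform probability is nearly uniform in most
coordinates, in terms of its total. -/
theorem sum_test_le {A X : Type} [Fintype A] [Fintype X] [Nonempty X] {N : ℕ} {α : A → ℝ}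
    {p : A → Fin N → X} (hα : SubUniform 1 α p) {φ : Fin N → X → ℝ}
    (hφ : ∀ i x, 0 ≤ φ i x ∧ φ i x ≤ 1) {lam : ℝ} (h0 : 0 ≤ lam) (h1 : lam ≤ 1) (c : ℝ) :
    lam * ∑ i, ∑ a, α a * (φ i (p a i) - (∑ x, φ i x) / Fintype.card X) ≤
      (∑ a, α a) * (lam ^ 2 * N + c) + Real.exp (-c) := by
  classical
  set ψ : Fin N → X → ℝ := fun i x => lam * (φ i x - (∑ x, φ i x) / Fintype.card X) with hψ
  set Z : (Fin N → X) → ℝ := fun s => ∑ i, ψ i (s i) with hZ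
  set b := lam ^ 2 * N with hb
  have hX : (0 : ℝ) < Fintype.card X := by exact_mod_cast Fintype.card_pos
  -- Under the uniform probability the coordinates are independent, so the exponential moment
  -- factorizes.
  have hmom : ∑ a, α a * Real.exp (Z (p a)) ≤ Real.exp b := by
    refine (hα.sum_mul_le (g := fun s => Real.exp (Z s)) fun s => (Real.exp_pos _).le).trans ?_
    have e : ∑ s : Fin N → X, Real.exp (Z s) = ∏ i, ∑ x, Real.exp (ψ i x) := by
      rw [Fintype.prod_sum]
      exact Finset.sum_congr rfl fun s _ => by rw [hZ]; exact Real.exp_sum _ _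
    rw [e]
    have e2 : ∏ i, ∑ x, Real.exp (ψ i x) ≤ ∏ _i : Fin N, (Fintype.card X * Real.exp (lam ^ 2)) :=
      Finset.prod_le_prod (fun i _ => Finset.sum_nonneg fun x _ => (Real.exp_pos _).le)
        fun i _ => sum_exp_centered_le (hφ i) h0 h1
    have e3 : Real.exp b = Real.exp (lam ^ 2) ^ N := by rw [hb, ← Real.exp_nat_mul, mul_comm]
    rw [Finset.prod_const, Finset.card_univ, Fintype.card_fin, mul_pow] at e2
    rw [Fintype.card_fun, Fintype.card_fin, e3, div_mul_eq_mul_div, one_mul,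
      div_le_iff₀ (by positivity)]
    push_cast
    linarith
  -- This is `1 + z ≤ exp z` at `z = Z - (b + c)`. It bounds the mean of `Z` under `α` without
  -- normalizing `α`, at the price of the additive term `exp (-c)`.
  have hlow : ∑ a, α a * (1 + Z (p a) - (b + c)) ≤ Real.exp (-(b + c)) * Real.exp b := by
    refine le_trans ?_ (mul_le_mul_of_nonneg_left hmom (Real.exp_pos _).le)
    rw [Finset.mul_sum]
    refine Finset.sum_le_sum fun a _ => ?_
    have := mul_le_mul_of_nonneg_left (Real.add_one_le_exp (-(b + c) + Z (p a))) (hα.1 a)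
    rw [Real.exp_add] at this
    linarith
  rw [← Real.exp_add] at hlow
  have e4 : ∑ a, α a * (1 + Z (p a) - (b + c)) =
      ∑ a, α a * Z (p a) + (∑ a, α a) * (1 - (b + c)) := by
    rw [Finset.sum_mul, ← Finset.sum_add_distrib]
    exact Finset.sum_congr rfl fun a _ => by ring
  have e5 : lam * ∑ i, ∑ a, α a * (φ i (p a i) - (∑ x, φ i x) / Fintype.card X) =
      ∑ a, α a * Z (p a) := by
    simp only [hZ, hψ, Finset.mul_sum]
    rw [Finset.sum_comm]
    exact Finset.sum_congr rfl fun a _ => Finset.sum_congr rfl fun i _ => by ring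
  have e6 : 0 ≤ ∑ a, α a := Finset.sum_nonneg fun a _ => hα.1 a
  have e7 : -(b + c) + b = -c := by ring
  rw [e7, e4] at hlow
  rw [e5]
  linarith

/-! ### Round elimination -/

/-- The other party of the composed game, once its index is fixed. -/
theorem SubUniform.restrict_fst {B S : Type} [Fintype B] [Fintype S] {N : ℕ} {β : B → ℝ}
    {q : B → Fin N × S} (hβ : SubUniform 1 β q) (i : Fin N) :
    SubUniform (1 / N) (fun b => if (q b).1 = i then β b else 0) (fun b => (q b).2) := by
  classical
  refine ⟨fun b => ?_, fun y => ?_⟩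
  · dsimp only
    split_ifs
    exacts [hβ.1 b, le_rfl]
  · have h := hβ.2 (i, y)
    rw [Fintype.card_prod, Fintype.card_fin, Nat.cast_mul, ← div_div] at h
    refine le_trans (le_of_eq (Finset.sum_congr rfl fun b _ => ?_)) h
    by_cases h1 : (q b).1 = i <;> by_cases h2 : (q b).2 = y <;> simp [Prod.ext_iff, h1, h2]

/-- Round elimination: in the composed game the speaker has `N` copies of the game, in the role of
the second party, and the other party has an index and the input of the first party. -/
theorem HardGame.step {M : Type} [Fintype M] [Nonempty M] {t : ℕ} {ε : ℝ} (hε : 0 ≤ ε)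
    {S T : Type} [Fintype S] [Fintype T] [Nonempty S] [Nonempty T] {ans : S → T → Bool}
    (h : HardGame M t ε ans) {N : ℕ} (hN : 0 < N) {lam : ℝ} (h0 : 0 < lam) (h1 : lam ≤ 1) :
    HardGame M (t + 1) (ε + (lam + (Real.log (Fintype.card M) + 1) / (lam * N)))
      (fun (s : Fin N → T) (y : Fin N × S) => ans y.2 (s y.1)) := by
  classical
  rintro A B _ _ p q α β hα hβ F ⟨f, G, hG, hFG⟩
  set αm : M → A → ℝ := fun m a => if f a = m then α a else 0 with hαm
  have hαm0 : ∀ m a, 0 ≤ αm m a := fun m a => by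
    simp only [hαm]
    split_ifs
    exacts [hα.1 a, le_rfl]
  have hαmu : ∀ m, SubUniform 1 (αm m) p := fun m => hα.mono (hαm0 m) fun a => by
    simp only [hαm]
    split_ifs
    exacts [le_rfl, hα.1 a]
  set w : M → ℝ := fun m => ∑ a, αm m a with hw
  have hw0 : ∀ m, 0 ≤ w m := fun m => Finset.sum_nonneg fun a _ => hαm0 m a
  have hw1 : ∑ m, w m ≤ 1 := by
    refine le_trans (le_of_eq ?_) hα.sum_le
    simp only [hw, hαm]
    rw [Finset.sum_comm]
    simp
  -- Given the message `m`, copy `i` need no longer be uniform. After truncation it is at most `w m`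
  -- times uniform, so the hypothesis on the smaller game applies; the other copies are extra
  -- knowledge of the speaker, which `HardGame` permits. The mass `lost m i` is conceded as success.
  choose α' φ hle hsub hφ hlost using
    fun (m : M) (i : Fin N) => exists_truncation (hαm0 m) (fun a => p a i)
  set lost : M → Fin N → ℝ := fun m i => ∑ a, (αm m a - α' m i a) with hlostdef
  have hNpos : (0 : ℝ) < N := by exact_mod_cast hN
  have hMpos : (1 : ℝ) ≤ Fintype.card M := by exact_mod_cast Fintype.card_pos
  -- With this choice the error terms `exp (-c)`, one for each message, add up to 1.
  set c := Real.log (Fintype.card M) with hc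
  have hc0 : 0 ≤ c := Real.log_nonneg hMpos
  have hexp : Real.exp (-c) = 1 / Fintype.card M := by
    rw [Real.exp_neg, hc, Real.exp_log (by linarith), one_div]
  have hlostsum : lam * ∑ m, ∑ i, lost m i ≤ lam ^ 2 * N + c + 1 := by
    rw [Finset.mul_sum]
    calc ∑ m, lam * ∑ i, lost m i
        ≤ ∑ m, (w m * (lam ^ 2 * N + c) + Real.exp (-c)) := by
          refine Finset.sum_le_sum fun m _ => ?_
          simp only [hlostdef, hlost]
          exact sum_test_le (hαmu m) (hφ m) h0.le h1 c
      _ = (∑ m, w m) * (lam ^ 2 * N + c) + 1 := by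
          rw [Finset.sum_add_distrib, ← Finset.sum_mul, hexp]
          simp
      _ ≤ 1 * (lam ^ 2 * N + c) + 1 := by gcongr
      _ = _ := by ring
  set βi : Fin N → B → ℝ := fun i b => if (q b).1 = i then β b else 0 with hβi
  have hβu : ∀ i, SubUniform (1 / N) (βi i) (fun b => (q b).2) := hβ.restrict_fst
  have hmi : ∀ m i, ∑ b, ∑ a, βi i b * αm m a *
      (if G m b a = ans (q b).2 (p a i) then 1 else 0) ≤
        1 / N * w m * ε + 1 / N * lost m i := by
    intro m i
    have e1 := h.sum_le (by positivity) (hw0 m) (hβu i) (hsub m i) (hG m)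
    have e2 : (∑ b, βi i b) * lost m i ≤ 1 / N * lost m i :=
      mul_le_mul_of_nonneg_right (hβu i).sum_le (Finset.sum_nonneg fun a _ => sub_nonneg.2 (hle m i a))
    refine le_trans ?_ (add_le_add e1 e2)
    simp only [hlostdef]
    rw [Finset.sum_mul_sum, ← Finset.sum_add_distrib]
    refine Finset.sum_le_sum fun b _ => ?_
    rw [← Finset.sum_add_distrib]
    refine Finset.sum_le_sum fun a _ => ?_
    have := mul_nonneg ((hβu i).1 b) (sub_nonneg.2 (hle m i a))
    split_ifs <;> linarith
  calc ∑ a, ∑ b, α a * β b * (if F a b = ans (q b).2 (p a (q b).1) then 1 else 0)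
      = ∑ m, ∑ i, ∑ b, ∑ a, βi i b * αm m a *
          (if G m b a = ans (q b).2 (p a i) then 1 else 0) := by
        have e : ∀ a b, α a * β b * (if F a b = ans (q b).2 (p a (q b).1) then 1 else 0) =
            ∑ m, ∑ i, βi i b * αm m a *
              (if G m b a = ans (q b).2 (p a i) then 1 else 0) := by
          intro a b
          rw [Finset.sum_eq_single (f a), Finset.sum_eq_single (q b).1]
          · simp [hβi, hαm, hFG, mul_comm]
          · intro i _ hi
            simp [hβi, hi.symm]
          · simp
          · intro m _ hm
            simp [hαm, hm.symm]
          · simp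
        simp_rw [e]
        rw [Finset.sum_comm]
        calc ∑ b, ∑ a, ∑ m, ∑ i, βi i b * αm m a *
              (if G m b a = ans (q b).2 (p a i) then (1 : ℝ) else 0)
            = ∑ b, ∑ m, ∑ i, ∑ a, βi i b * αm m a *
              (if G m b a = ans (q b).2 (p a i) then (1 : ℝ) else 0) := by
              refine Finset.sum_congr rfl fun b _ => ?_
              rw [Finset.sum_comm]
              exact Finset.sum_congr rfl fun m _ => Finset.sum_comm
          _ = _ := by
              rw [Finset.sum_comm]
              exact Finset.sum_congr rfl fun m _ => Finset.sum_comm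
    _ ≤ ∑ m, ∑ i, (1 / N * w m * ε + 1 / N * lost m i) :=
        Finset.sum_le_sum fun m _ => Finset.sum_le_sum fun i _ => hmi m i
    _ = (∑ m, w m) * ε + (lam * ∑ m, ∑ i, lost m i) / (lam * N) := by
        simp_rw [Finset.sum_add_distrib, ← Finset.mul_sum, Finset.sum_const, Finset.card_univ,
          Fintype.card_fin, Finset.sum_mul, nsmul_eq_mul]
        congr 1
        · refine Finset.sum_congr rfl fun m _ => ?_
          field_simp
        · field_simp
    _ ≤ 1 * ε + (lam ^ 2 * N + c + 1) / (lam * N) := by gcongr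
    _ = _ := by
        field_simp
        ring

/-! ### Realization of the games by touching lines -/

/-- The inputs of a game as families of lines `(p, q)`, standing for `x ↦ p * x + q`: the upper
envelope of the first family and the negative of the upper envelope of the second family touch in
exactly one point, its abscissa is an integer, and its parity is the answer of the game. The
numbers `M` and `R` bound the slopes and the abscissa. -/
structure TouchingLines {S T ι κ : Type} (ans : S → T → Bool) (P : S → ι → ℤ × ℤ)
    (Q : T → κ → ℤ × ℤ) (M R : ℤ) : Prop where
  one_le : 1 ≤ M
  even : Even R
  bound_fst : ∀ s l, |(P s l).1| ≤ M ∧ |(P s l).2| ≤ 2 * M * R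
  bound_snd : ∀ y l, |(Q y l).1| ≤ M ∧ |(Q y l).2| ≤ 2 * M * R
  touch : ∀ s y, ∃ x v : ℤ, 0 ≤ x ∧ x < R ∧ decide (x % 2 = 1) = ans s y ∧
    (∀ l, (P s l).1 * x + (P s l).2 ≤ v) ∧ (∀ l, (Q y l).1 * x + (Q y l).2 ≤ -v) ∧
    (∃ l l', (P s l).1 * x + (P s l).2 = v ∧ (Q y l').1 * x + (Q y l').2 = -v ∧
      0 < (P s l).1 + (Q y l').1) ∧
    (∃ l l', (P s l).1 * x + (P s l).2 = v ∧ (Q y l').1 * x + (Q y l').2 = -v ∧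
      (P s l).1 + (Q y l').1 < 0)

/-- The second envelope is `|x|` or `|x - 1|` according to the bit, and its negative touches the
zero line at 0 or 1. -/
theorem touchingLines_bit :
    TouchingLines (fun (_ : Unit) (b : Bool) => b) (fun _ (_ : Unit) => ((0, 0) : ℤ × ℤ))
      (fun b (l : Bool) => if l then (1, if b then -1 else 0) else (-1, if b then 1 else 0))
      1 2 where
  one_le := le_rfl
  even := even_two
  bound_fst := by simp
  bound_snd := by decide
  touch := by
    rintro - b
    refine ⟨if b then 1 else 0, 0, ?_⟩
    cases b <;> simp

/-- The slope and intercept of the line `l` moved to the right by `o`, plus the line `c`. -/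
def moveLine (l : ℤ × ℤ) (o : ℤ) (c : ℤ × ℤ) : ℤ × ℤ := (l.1 + c.1, l.2 - l.1 * o + c.2)

theorem moveLine_eval (l : ℤ × ℤ) (o : ℤ) (c : ℤ × ℤ) (x : ℤ) :
    (moveLine l o c).1 * (o + x) + (moveLine l o c).2 =
      l.1 * x + l.2 + (c.1 * (o + x) + c.2) := by
  simp only [moveLine]
  ring

/-- The left end of the block with index `j`. -/
def blockStart (R j : ℤ) : ℤ := 3 * R * j + R

/-- The chord over the block with index `j` of a parabola. -/
def chord (M R j : ℤ) : ℤ × ℤ := (10 * M * j, -(15 * M * R * (j * (j + 1))))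

/-- The new slope is at most `M + 10 * M * (N - 1)`. The new intercept collects at most `2 * M * R`
from the old one, `3 * M * R * N` from the shift and `15 * M * R * N ^ 2` from the chord, within the
allowed `66 * M * R * N ^ 2`. -/
theorem bound_moveLine {M R N j : ℤ} {l : ℤ × ℤ} (hM : 1 ≤ M) (hR : 0 ≤ R) (hj : 0 ≤ j)
    (hjN : j + 1 ≤ N) (h1 : |l.1| ≤ M) (h2 : |l.2| ≤ 2 * M * R) :
    (|(moveLine l (blockStart R j) (chord M R j)).1| ≤ 11 * N * M ∧
      |(moveLine l (blockStart R j) (chord M R j)).2| ≤ 2 * (11 * N * M) * (3 * N * R)) ∧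
    (|(moveLine l (blockStart R j) (-chord M R j)).1| ≤ 11 * N * M ∧
      |(moveLine l (blockStart R j) (-chord M R j)).2| ≤ 2 * (11 * N * M) * (3 * N * R)) := by
  have a1 : |10 * M * j| ≤ 10 * M * (N - 1) := by
    rw [abs_of_nonneg (by positivity)]
    gcongr
    linarith
  have a2 : |l.1 * blockStart R j| ≤ M * (3 * R * N) := by
    rw [abs_mul]
    refine mul_le_mul h1 ?_ (abs_nonneg _) (by linarith)
    rw [blockStart, abs_of_nonneg (by positivity)]
    nlinarith
  have a3 : |15 * M * R * (j * (j + 1))| ≤ 15 * M * R * (N * N) := by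
    rw [abs_of_nonneg (by positivity)]
    gcongr
    linarith
    linarith
  have hN : 1 ≤ N := by linarith
  have a4 : M ≤ N * M := by nlinarith
  have hMR : 0 ≤ M * R := by positivity
  have a5 : M * R ≤ M * R * N := by nlinarith
  have a6 : M * R * N ≤ M * R * N * N := by nlinarith
  simp only [moveLine, chord, Prod.fst_neg, Prod.snd_neg, abs_le] at *
  refine ⟨⟨⟨?_, ?_⟩, ?_, ?_⟩, ⟨?_, ?_⟩, ?_, ?_⟩ <;> nlinarith

/-- In the block with index `i` the line of another block stays below. -/
theorem moveLine_le {M R i j x : ℤ} {l l₀ : ℤ × ℤ} (hM : 1 ≤ M) (hx : 0 ≤ x) (hxR : x < R)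
    (hij : j ≠ i) (h1 : |l.1| ≤ M) (h2 : |l.2| ≤ 2 * M * R) (h3 : |l₀.1| ≤ M)
    (h4 : |l₀.2| ≤ 2 * M * R) :
    (moveLine l (blockStart R j) (chord M R j)).1 * (blockStart R i + x) +
      (moveLine l (blockStart R j) (chord M R j)).2 ≤
    (l₀.1 * x + l₀.2) + ((chord M R i).1 * (blockStart R i + x) + (chord M R i).2) := by
  obtain ⟨a, e⟩ := l
  obtain ⟨a₀, e₀⟩ := l₀
  obtain ⟨d, rfl⟩ : ∃ d, j = i + d := ⟨j - i, by ring⟩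
  have hd : d ≠ 0 := fun h => hij (by simp [h])
  have hMR : 0 ≤ M * R := mul_nonneg (by linarith) (by linarith)
  simp only [moveLine, chord, blockStart, abs_le] at *
  have k1 : a * x ≤ M * R := by nlinarith
  have k2 : -(a₀ * x) ≤ M * R := by nlinarith
  have hid : (a₀ * x + e₀ + (10 * M * i * (3 * R * i + R + x) + -(15 * M * R * (i * (i + 1))))) -
      ((a + 10 * M * (i + d)) * (3 * R * i + R + x) +
        (e - a * (3 * R * (i + d) + R) + -(15 * M * R * ((i + d) * (i + d + 1))))) =
      -- Neighbouring chords meet at multiples of `3 * R` with slopes differing by `10 * M`, and a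
      -- block is the middle third between two such points. So chord `i` exceeds chord `i + d` over
      -- block `i` by at least `10 * M * R * |d|`. The lines themselves account for at most `6 * M *
      -- R`, and the shift for at most `3 * M * R * |d|`, which leaves a nonnegative difference for
      -- `d ≠ 0`.
      a₀ * x + e₀ - a * x - e + 3 * R * (a * d) - 5 * M * (d * (2 * R + 2 * x - 3 * R * (d + 1))) := by
    ring
  rw [← sub_nonneg, hid]
  rcases lt_or_gt_of_ne hd with hd | hd
  · have k3 : -(M * R) * (-d) ≤ R * (a * d) := by
      have : 0 ≤ R * (-d) * (M - a) := by
        apply mul_nonneg (mul_nonneg _ _) <;> linarith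
      linarith
    have k4 : d * (2 * R + 2 * x - 3 * R * (d + 1)) ≤ 2 * R * d := by
      have : 0 ≤ (-d) * (2 * x + 3 * R * (-(d + 1))) := by
        refine mul_nonneg (by linarith) (add_nonneg (by linarith) (mul_nonneg (by linarith) ?_))
        linarith
      linarith
    have k5 : M * (d * (2 * R + 2 * x - 3 * R * (d + 1))) ≤ M * (2 * R * d) :=
      mul_le_mul_of_nonneg_left k4 (by linarith)
    have k6 : M * R * 1 ≤ M * R * (-d) := mul_le_mul_of_nonneg_left (by linarith) hMR
    linarith
  · have k3 : -(M * R) * d ≤ R * (a * d) := by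
      have : 0 ≤ R * d * (a + M) := by
        apply mul_nonneg (mul_nonneg _ _) <;> linarith
      linarith
    have k4 : d * (2 * R + 2 * x - 3 * R * (d + 1)) ≤ -(2 * R * d) := by
      have : 0 ≤ d * (2 * (R - x) + 3 * R * (d - 1)) := by
        refine mul_nonneg (by linarith) (add_nonneg (by linarith) (mul_nonneg (by linarith) ?_))
        linarith
      linarith
    have k5 : M * (d * (2 * R + 2 * x - 3 * R * (d + 1))) ≤ M * (-(2 * R * d)) :=
      mul_le_mul_of_nonneg_left k4 (by linarith)
    have k6 : M * R * 1 ≤ M * R * d := mul_le_mul_of_nonneg_left (by linarith) hMR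
    linarith

/-- The lines of the composed game. -/
theorem TouchingLines.step {S T ι κ : Type} [Nonempty S] [Nonempty T] {ans : S → T → Bool}
    {P : S → ι → ℤ × ℤ} {Q : T → κ → ℤ × ℤ} {M R : ℤ} (h : TouchingLines ans P Q M R) {N : ℕ}
    (hN : 0 < N) :
    TouchingLines (fun (s : Fin N → T) (y : Fin N × S) => ans y.2 (s y.1))
      (fun s (l : Fin N × κ) => moveLine (Q (s l.1) l.2) (blockStart R l.1) (chord M R l.1))
      (fun y l => moveLine (P y.2 l) (blockStart R y.1) (-chord M R y.1))
      (11 * N * M) (3 * N * R) := by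
  have hR : 0 ≤ R := by
    obtain ⟨s⟩ := ‹Nonempty S›
    obtain ⟨y⟩ := ‹Nonempty T›
    obtain ⟨x, v, h0, h1, -⟩ := h.touch s y
    exact h0.trans h1.le
  have hN' : (1 : ℤ) ≤ N := by exact_mod_cast hN
  have hj0 : ∀ j : Fin N, (0 : ℤ) ≤ (j : ℕ) := fun j => by positivity
  have hjN : ∀ j : Fin N, ((j : ℕ) : ℤ) + 1 ≤ N := fun j => by exact_mod_cast j.2
  refine ⟨?_, h.even.mul_left _, fun s l => ?_, fun y l => ?_, ?_⟩
  · have := h.one_le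
    nlinarith
  · exact (bound_moveLine h.one_le hR (hj0 _) (hjN _) (h.bound_snd _ _).1 (h.bound_snd _ _).2).1
  · exact (bound_moveLine h.one_le hR (hj0 _) (hjN _) (h.bound_fst _ _).1 (h.bound_fst _ _).2).2
  rintro s ⟨i, y⟩
  obtain ⟨x, v, hx0, hxR, hans, hP, hQ, ⟨l₁, l₁', t₁, t₁', p₁⟩, l₂, l₂', t₂, t₂', p₂⟩ :=
    h.touch y (s i)
  -- An even shift preserves the parity of the abscissa, hence the answer.
  have hev : Even (blockStart R i) := by
    unfold blockStart
    exact ((h.even.mul_left _).mul_right _).add h.even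
  set o := blockStart R i with ho
  set c := chord M R i with hc
  have hneg : ∀ a : ℤ × ℤ, (moveLine a o (-c)).1 * (o + x) + (moveLine a o (-c)).2 =
      a.1 * x + a.2 - (c.1 * (o + x) + c.2) := fun a => by
    rw [moveLine_eval, Prod.fst_neg, Prod.snd_neg]
    ring
  -- The parties exchange roles, so the height changes sign before the tilt `c` is added. The slope
  -- sums at the contact are unchanged because `c` and `-c` cancel.
  refine ⟨o + x, -v + (c.1 * (o + x) + c.2), ?_, ?_, ?_, ?_, ?_, ⟨(i, l₁'), l₁, ?_, ?_, ?_⟩,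
    (i, l₂'), l₂, ?_, ?_, ?_⟩
  · have := hj0 i
    rw [ho, blockStart]
    positivity
  · have := hjN i
    rw [ho, blockStart]
    nlinarith
  · rw [← hans]
    obtain ⟨e, he⟩ := hev
    congr 1
    rw [he]
    exact propext (by omega)
  · rintro ⟨j, l⟩
    by_cases hji : j = i
    · subst hji
      rw [moveLine_eval]
      linarith [hQ l]
    · refine (moveLine_le h.one_le hx0 hxR (fun h => hji (Fin.ext (by exact_mod_cast h)))
        (h.bound_snd _ _).1 (h.bound_snd _ _).2 (h.bound_snd (s i) l₁').1
        (h.bound_snd (s i) l₁').2).trans ?_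
      linarith
  · intro l
    dsimp only
    rw [hneg]
    linarith [hP l]
  · dsimp only
    rw [moveLine_eval, t₁']
  · dsimp only
    rw [hneg, t₁]
    ring
  · simp only [moveLine, Prod.fst_neg]
    linarith
  · dsimp only
    rw [moveLine_eval, t₂']
  · dsimp only
    rw [hneg, t₂]
    ring
  · simp only [moveLine, Prod.fst_neg]
    linarith

/-- Hard games with `t` messages from `M` that are realized by lines. -/
theorem exists_hardGame_touchingLines (M : Type) [Fintype M] [Nonempty M] {N : ℕ} (hN : 0 < N)
    {lam : ℝ} (h0 : 0 < lam) (h1 : lam ≤ 1) (t : ℕ) :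
    ∃ (S T ι κ : Type) (_ : Fintype S) (_ : Fintype T) (_ : Fintype ι) (_ : Fintype κ)
      (_ : Nonempty S) (_ : Nonempty T) (ans : S → T → Bool) (P : S → ι → ℤ × ℤ)
      (Q : T → κ → ℤ × ℤ),
      HardGame M t (1 / 2 + t * (lam + (Real.log (Fintype.card M) + 1) / (lam * N))) ans ∧
      TouchingLines ans P Q ((11 * N) ^ t) (2 * (3 * N) ^ t) ∧
      Fintype.card ι ≤ 2 * N ^ t ∧ Fintype.card κ ≤ 2 * N ^ t := by
  induction t with
  | zero =>
    exact ⟨Unit, Bool, Unit, Bool, inferInstance, inferInstance, inferInstance, inferInstance,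
      inferInstance, inferInstance, _, _, _, by simpa using hardGame_bit M,
      by simpa using touchingLines_bit, by simp, by simp⟩
  | succ t ih =>
    obtain ⟨S, T, ι, κ, _, _, _, _, _, _, ans, P, Q, hH, hL, hι, hκ⟩ := ih
    have hNpos : 0 < (N : ℝ) := by exact_mod_cast hN
    have hlog : 0 ≤ Real.log (Fintype.card M) :=
      Real.log_nonneg (by exact_mod_cast Fintype.card_pos)
    have : Nonempty (Fin N) := ⟨⟨0, hN⟩⟩
    classical
    have hL' := hL.step hN
    rw [← pow_succ', mul_left_comm, ← pow_succ'] at hL'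
    refine ⟨Fin N → T, Fin N × S, Fin N × κ, ι, inferInstance, inferInstance, inferInstance,
      inferInstance, inferInstance, inferInstance, _, _, _, ?_, hL', ?_, ?_⟩
    · have := hH.step (by positivity) hN h0 h1
      convert this using 1
      push_cast
      ring
    · rw [Fintype.card_prod, Fintype.card_fin, pow_succ']
      nlinarith
    · rw [pow_succ']
      nlinarith [Nat.one_le_pow t N hN]

/-! ### From the coordinator model to two parties -/

namespace CoordinatorProtocol

variable {k : ℕ} {Ω Z X O : Type*}

/-- The protocol in which the replies of the sites are cut off after `L` bits. -/
def truncate (π : CoordinatorProtocol k Ω Z X O) (L : ℕ) : CoordinatorProtocol k Ω Z X O where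
  query := π.query
  reply s ω z x l := (π.reply s ω z x l).take L
  output := π.output

/-- The messages after one more round. -/
def nextRound (π : CoordinatorProtocol k Ω Z X O) (ω : Ω) (z : Z) (x : Fin k → X)
    (past : List ((Fin k → Message) × (Fin k → Message))) :
    List ((Fin k → Message) × (Fin k → Message)) :=
  past ++ [(π.query ω z (past.map Prod.snd), fun s => π.reply s ω z (x s)
    (past.map (fun m => m.1 s) ++ [π.query ω z (past.map Prod.snd) s]))]

/-- `transcript` splits off the last round, while `TwoPartyComputable` splits off the first message.
As an iterate, the run can be unfolded from its first round with an arbitrary past. -/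
theorem transcript_eq_iterate (π : CoordinatorProtocol k Ω Z X O) (ω : Ω) (z : Z)
    (x : Fin k → X) (r : ℕ) : π.transcript ω z x r = (π.nextRound ω z x)^[r] [] := by
  induction r with
  | zero => rfl
  | succ r ih =>
    rw [Function.iterate_succ_apply', ← ih]
    rfl

theorem transcript_truncate (π : CoordinatorProtocol k Ω Z X O) {L r : ℕ} {ω : Ω} {z : Z}
    {x : Fin k → X} (h : π.communication r ω z x ≤ L) :
    (π.truncate L).transcript ω z x r = π.transcript ω z x r := by
  induction r with
  | zero => rfl
  | succ r ih =>
    simp only [communication, transcript, List.map_append, List.sum_append, List.map_cons,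
      List.map_nil, List.sum_cons, List.sum_nil, add_zero] at h
    have ih' := ih (le_trans (Nat.le_add_right _ _) h)
    change (π.truncate L).nextRound ω z x ((π.truncate L).transcript ω z x r) = _
    rw [ih']
    refine congrArg (fun f => π.transcript ω z x r ++
      [(π.query ω z ((π.transcript ω z x r).map Prod.snd), f)])
      (funext fun s => List.take_of_length_le ?_)
    have := Finset.single_le_sum (f := fun s : Fin k =>
      (π.query ω z (List.map Prod.snd (π.transcript ω z x r)) s).length +
      (π.reply s ω z (x s) (List.map (fun m => m.1 s) (π.transcript ω z x r) ++
        [π.query ω z (List.map Prod.snd (π.transcript ω z x r)) s])).length)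
      (fun _ _ => Nat.zero_le _) (Finset.mem_univ s)
    refine (le_trans (Nat.le_add_left _ _) this).trans ?_
    omega

theorem result_truncate (π : CoordinatorProtocol k Ω Z X O) {L r : ℕ} {ω : Ω} {z : Z}
    {x : Fin k → X} (h : π.communication r ω z x ≤ L) :
    (π.truncate L).result r ω z x = π.result r ω z x := by
  rw [result, result, π.transcript_truncate h]
  rfl

/-- If only two sites have inputs that are not fixed, `r` rounds in the coordinator model are
simulated by `2 * r` alternating messages. -/
theorem twoPartyComputable_truncate (π : CoordinatorProtocol k Ω Z X O) (L : ℕ) {A B : Type}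
    (s₀ s₁ : Fin k) (xa : A → X) (xb : B → X) (xo : Fin k → X) (ω : Ω) (z : Z) (D : O → Bool)
    (r : ℕ) (past : List ((Fin k → Message) × (Fin k → Message))) :
    TwoPartyComputable {l : List Bool // l.length ≤ L} (2 * r) (fun (a : A) (b : B) =>
      D (π.output ω z ((((π.truncate L).nextRound ω z
        (fun s => if s = s₀ then xa a else if s = s₁ then xb b else xo s))^[r] past).map
          Prod.snd))) := by
  induction r generalizing past with
  | zero => exact ⟨D (π.output ω z (past.map Prod.snd)), fun _ _ => rfl⟩
  | succ r ih =>
    set q := π.query ω z (past.map Prod.snd)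
    set seen : Fin k → List Message := fun s => past.map (fun m => m.1 s) ++ [q s]
    set rep : Fin k → X → {l : List Bool // l.length ≤ L} := fun s y =>
      ⟨(π.reply s ω z y (seen s)).take L, by simp⟩
    -- One round costs two messages, the replies of `s₀` and `s₁`. The queries are determined by the
    -- coins and the earlier replies, and the other sites have fixed inputs, so all else is computed
    -- by both parties.
    refine ⟨fun a => rep s₀ (xa a), fun m b a => _, fun m => ⟨fun b => rep s₁ (xb b),
      fun m' a b => _, fun m' => ih (past ++ [(q, fun s =>
        if s = s₀ then m.1 else if s = s₁ then m'.1 else (rep s (xo s)).1)]),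
        fun _ _ => rfl⟩, fun a b => ?_⟩
    dsimp only
    rw [Function.iterate_succ_apply]
    refine congrArg (fun f => D (π.output ω z (List.map Prod.snd
      (((π.truncate L).nextRound ω z _)^[r] (past ++ [(q, f)]))))) (funext fun s => ?_)
    change (π.reply s ω z (if s = s₀ then xa a else if s = s₁ then xb b else xo s)
      (seen s)).take L = _
    split_ifs with h₀ h₁
    · subst h₀; rfl
    · subst h₁; rfl
    · rfl

end CoordinatorProtocol

theorem TwoPartyComputable.exists_const {M : Type} [Subsingleton M] {t : ℕ} {A B : Type}
    {F : A → B → Bool} (h : TwoPartyComputable M t F) : ∃ o, ∀ a b, F a b = o := by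
  induction t generalizing A B with
  | zero => exact h
  | succ t ih =>
    obtain ⟨f, G, hG, hF⟩ := h
    rcases isEmpty_or_nonempty A with _ | ⟨⟨a₀⟩⟩
    · exact ⟨true, fun a => isEmptyElim a⟩
    · obtain ⟨o, ho⟩ := ih (hG (f a₀))
      exact ⟨o, fun a b => by rw [hF, Subsingleton.elim (f a) (f a₀), ho]⟩

noncomputable instance boundedMessageFintype (L : ℕ) :
    Fintype {l : List Bool // l.length ≤ L} :=
  (List.finite_length_le Bool L).fintype

instance (L : ℕ) : Nonempty {l : List Bool // l.length ≤ L} := ⟨⟨[], Nat.zero_le _⟩⟩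

/-- Each of the `L` positions of a string holds one of two bits or is past the end. -/
theorem card_boundedMessage_le (L : ℕ) :
    Fintype.card {l : List Bool // l.length ≤ L} ≤ 3 ^ L := by
  have h : Function.Injective
      (fun (l : {l : List Bool // l.length ≤ L}) (i : Fin L) => l.1[(i : ℕ)]?) := by
    intro l l' h
    refine Subtype.ext (List.ext_getElem? fun i => ?_)
    by_cases hi : i < L
    · exact congrFun h ⟨i, hi⟩
    · rw [List.getElem?_eq_none (l.2.trans (not_lt.1 hi)),
        List.getElem?_eq_none (l'.2.trans (not_lt.1 hi))]
  simpa using Fintype.card_le_of_injective _ h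

theorem log_card_boundedMessage_le (L : ℕ) :
    Real.log (Fintype.card {l : List Bool // l.length ≤ L}) ≤ 2 * L := by
  have h0 : (0 : ℝ) < Fintype.card {l : List Bool // l.length ≤ L} := by
    exact_mod_cast Fintype.card_pos
  have h1 : (Fintype.card {l : List Bool // l.length ≤ L} : ℝ) ≤ 3 ^ L := by
    exact_mod_cast card_boundedMessage_le L
  refine (Real.log_le_log h0 h1).trans ?_
  rw [Real.log_pow, mul_comm]
  gcongr
  linarith [Real.log_le_sub_one_of_pos (show (0 : ℝ) < 3 by norm_num)]

/-- For a family of linear programs in which the constraints of the site `s₀` depend only on the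
first parameter and those of the site `s₁` only on the second one, an algorithm in the coordinator
model yields a two-party protocol, by fixing the best coins. -/
theorem exists_twoPartyComputable {n k r L : ℕ} {Ω : Type*} [MeasurableSpace Ω] {μ : Measure Ω}
    [IsProbabilityMeasure μ] {π : LPCoordinatorProtocol 2 n k Ω} {B : ℤ} {ε : ℝ}
    (hπ : LPCoordinatorProtocol.SolvesWithProb π r μ B ε) {S T : Type} [Fintype S] [Fintype T]
    [Nonempty S] [Nonempty T] {ans : S → T → Bool} {prog : S → T → LinearProgram 2 n}
    {owner : Fin n → Fin k} {s₀ s₁ : Fin k} (hs : s₀ ≠ s₁) {z : Fin 2 → ℤ}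
    (hobj : ∀ s y, (prog s y).obj = z)
    (hS : ∀ s s' y j, owner j ≠ s₀ → (prog s y).con j = (prog s' y).con j)
    (hT : ∀ s y y' j, owner j ≠ s₁ → (prog s y).con j = (prog s y').con j)
    (hsol : ∀ s y, (prog s y).Solvable) (hB : ∀ s y, (prog s y).EntriesBounded B)
    {dec : (Fin 2 → ℝ) → Bool} (hdec : ∀ s y x, (prog s y).IsOptimal x → dec x = ans s y)
    (hcomm : ∀ s y ω, LPCoordinatorProtocol.lpCommunication π r (prog s y) owner ω ≤ L) :
    ∃ F : S → T → Bool, TwoPartyComputable {l : List Bool // l.length ≤ L} (2 * r) F ∧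
      ε ≤ ∑ s, ∑ y, 1 / (Fintype.card S : ℝ) * (1 / (Fintype.card T : ℝ)) *
        (if F s y = ans s y then 1 else 0) := by
  classical
  obtain ⟨sd⟩ := ‹Nonempty S›
  obtain ⟨yd⟩ := ‹Nonempty T›
  have hcS : (Fintype.card S : ℝ) ≠ 0 := by
    have := Fintype.card_pos_iff.2 ⟨sd⟩
    positivity
  have hcT : (Fintype.card T : ℝ) ≠ 0 := by
    have := Fintype.card_pos_iff.2 ⟨yd⟩
    positivity
  set E : S → T → Set Ω := fun s y =>
    {ω | (prog s y).IsOptimal (LPCoordinatorProtocol.lpResult π r (prog s y) owner ω)}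
  have hE : ∀ s y, MeasurableSet (E s y) ∧ ε ≤ μ.real (E s y) := fun s y =>
    hπ (prog s y) (hsol s y) (hB s y) owner
  set c : ℝ := 1 / (Fintype.card S : ℝ) * (1 / (Fintype.card T : ℝ)) with hc
  have hc0 : 0 ≤ c := by positivity
  have hint : ∀ s y, Integrable (fun ω => c * (E s y).indicator 1 ω) μ := fun s y =>
    ((integrable_const (1 : ℝ)).indicator (hE s y).1).const_mul c
  -- Averaging: some outcome of the coins succeeds on uniform inputs at least as often as the mean
  -- over all coins.
  obtain ⟨ω, hω⟩ := exists_integral_le (μ := μ)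
    (f := fun ω => ∑ s, ∑ y, c * (E s y).indicator 1 ω)
    (integrable_finsetSum _ fun s _ => integrable_finsetSum _ fun y _ => hint s y)
  have hlow : ε ≤ ∫ ω, ∑ s, ∑ y, c * (E s y).indicator 1 ω ∂μ := by
    rw [integral_finsetSum _ fun s _ => integrable_finsetSum _ fun y _ => hint s y]
    calc ε = ∑ _s : S, ∑ _y : T, c * ε := by
          simp only [Finset.sum_const, Finset.card_univ, nsmul_eq_mul, hc]
          field_simp
      _ ≤ _ := by
          refine Finset.sum_le_sum fun s _ => ?_
          rw [integral_finsetSum _ fun y _ => hint s y]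
          refine Finset.sum_le_sum fun y _ => ?_
          rw [integral_const_mul, integral_indicator_one (hE s y).1]
          exact mul_le_mul_of_nonneg_left (hE s y).2 hc0
  refine ⟨fun s y => dec (LPCoordinatorProtocol.lpResult π r (prog s y) owner ω), ?_,
    hlow.trans (hω.trans (Finset.sum_le_sum fun s _ => Finset.sum_le_sum fun y _ =>
      mul_le_mul_of_nonneg_left ?_ hc0))⟩
  -- The parameter on which a site does not depend is replaced by the default `sd` or `yd`, so each
  -- party computes its site's input alone.
  · have hsite : ∀ s y, (prog s y).siteInput owner = fun s' =>
        if s' = s₀ then (prog s yd).siteInput owner s₀ else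
          if s' = s₁ then (prog sd y).siteInput owner s₁ else
            (prog sd yd).siteInput owner s' := by
      intro s y
      funext s' j
      split_ifs with h₀ h₁
      · subst h₀
        simp only [LinearProgram.siteInput]
        split_ifs with h
        · rw [hT s y yd j (h ▸ hs)]
        · rfl
      · subst h₁
        simp only [LinearProgram.siteInput]
        split_ifs with h
        · rw [hS s sd y j (h ▸ hs.symm)]
        · rfl
      · simp only [LinearProgram.siteInput]
        split_ifs with h
        · rw [hS s sd y j (h ▸ h₀), hT sd y yd j (h ▸ h₁)]
        · rfl
    have hcomp := π.twoPartyComputable_truncate L s₀ s₁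
      (fun s => (prog s yd).siteInput owner s₀) (fun y => (prog sd y).siteInput owner s₁)
      ((prog sd yd).siteInput owner) ω z dec r []
    convert hcomp using 3 with s y
    have h1 := hcomm s y ω
    rw [LPCoordinatorProtocol.lpCommunication, hobj] at h1
    rw [LPCoordinatorProtocol.lpResult, hobj, ← π.result_truncate h1,
      CoordinatorProtocol.result, CoordinatorProtocol.transcript_eq_iterate, hsite]
    rfl
  · by_cases h : ω ∈ E s y
    · rw [if_pos (hdec s y _ h)]
      simp [h]
    · rw [Set.indicator_of_notMem h]
      split_ifs <;> simp

/-! ### Linear programs from touching lines -/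

/-- The linear program `y ≥ P x`, `y ≤ -Q x` for two families of lines that are placed in the slots
of the constraints, with the objective `y`. -/
def lineProgram {n : ℕ} {ι κ : Type} (slot : Fin n → Option (ι ⊕ κ)) (P : ι → ℤ × ℤ)
    (Q : κ → ℤ × ℤ) : LinearProgram 2 n where
  obj := ![0, 1]
  con j := match slot j with
    | some (Sum.inl l) => (![(P l).1, -1], -(P l).2)
    | some (Sum.inr l) => (![(Q l).1, 1], -(Q l).2)
    | none => (0, 0)

theorem lineProgram_feasible_iff {n : ℕ} {ι κ : Type} {slot : Fin n → Option (ι ⊕ κ)}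
    (hslot : ∀ c, ∃ j, slot j = some c) {P : ι → ℤ × ℤ} {Q : κ → ℤ × ℤ} {x : Fin 2 → ℝ} :
    (lineProgram slot P Q).Feasible x ↔
      (∀ l, ((P l).1 : ℝ) * x 0 + (P l).2 ≤ x 1) ∧ ∀ l, ((Q l).1 : ℝ) * x 0 + (Q l).2 ≤ -x 1 := by
  constructor
  · refine fun h => ⟨fun l => ?_, fun l => ?_⟩
    · obtain ⟨j, hj⟩ := hslot (Sum.inl l)
      have := h j
      simp [lineProgram, hj] at this
      linarith
    · obtain ⟨j, hj⟩ := hslot (Sum.inr l)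
      have := h j
      simp [lineProgram, hj] at this
      linarith
  · rintro ⟨hP, hQ⟩ j
    rcases hj : slot j with _ | l | l
    · simp [lineProgram, hj]
    · simp [lineProgram, hj]
      linarith [hP l]
    · simp [lineProgram, hj]
      linarith [hQ l]

/-- The feasible points of a line program are reduced to one if the lines touch. -/
theorem lineProgram_feasible_iff_eq {n : ℕ} {ι κ : Type} {slot : Fin n → Option (ι ⊕ κ)}
    (hslot : ∀ c, ∃ j, slot j = some c) {P : ι → ℤ × ℤ} {Q : κ → ℤ × ℤ} {x v : ℤ}
    (hP : ∀ l, (P l).1 * x + (P l).2 ≤ v) (hQ : ∀ l, (Q l).1 * x + (Q l).2 ≤ -v)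
    (hpos : ∃ l l', (P l).1 * x + (P l).2 = v ∧ (Q l').1 * x + (Q l').2 = -v ∧
      0 < (P l).1 + (Q l').1)
    (hneg : ∃ l l', (P l).1 * x + (P l).2 = v ∧ (Q l').1 * x + (Q l').2 = -v ∧
      (P l).1 + (Q l').1 < 0) {z : Fin 2 → ℝ} :
    (lineProgram slot P Q).Feasible z ↔ z = ![(x : ℝ), (v : ℝ)] := by
  rw [lineProgram_feasible_iff hslot]
  constructor
  · rintro ⟨h1, h2⟩
    obtain ⟨l, l', e, e', hs⟩ := hpos
    obtain ⟨m, m', f, f', hs'⟩ := hneg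
    have E : ((P l).1 : ℝ) * x + (P l).2 = v := by exact_mod_cast e
    have E' : ((Q l').1 : ℝ) * x + (Q l').2 = -v := by exact_mod_cast e'
    have G : ((P m).1 : ℝ) * x + (P m).2 = v := by exact_mod_cast f
    have G' : ((Q m').1 : ℝ) * x + (Q m').2 = -v := by exact_mod_cast f'
    have H : (0 : ℝ) < (P l).1 + (Q l').1 := by exact_mod_cast hs
    have H' : ((P m).1 : ℝ) + (Q m').1 < 0 := by exact_mod_cast hs'
    -- Adding the constraints of two lines that are tight at `(x, v)` eliminates the ordinate and
    -- leaves the slope sum times `z 0 - x` at most 0. The two signs of the slope sum give both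
    -- inequalities.
    have k1 : z 0 ≤ x := by nlinarith [h1 l, h2 l']
    have k2 : (x : ℝ) ≤ z 0 := by nlinarith [h1 m, h2 m']
    have k3 : z 0 = x := le_antisymm k1 k2
    have k4 := h1 l
    have k5 := h2 l'
    rw [k3] at k4 k5
    funext i
    fin_cases i
    · exact k3
    · show z 1 = v
      linarith
  · rintro rfl
    refine ⟨fun l => ?_, fun l => ?_⟩
    · have := hP l
      simp only [Matrix.cons_val_zero, Matrix.cons_val_one]
      exact_mod_cast this
    · have := hQ l
      simp only [Matrix.cons_val_zero, Matrix.cons_val_one]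
      exact_mod_cast this

theorem exists_slot {n : ℕ} {ι κ : Type} [Fintype ι] [Fintype κ]
    (h : Fintype.card ι + Fintype.card κ ≤ n) :
    ∃ slot : Fin n → Option (ι ⊕ κ), ∀ c, ∃ j, slot j = some c := by
  obtain ⟨e⟩ : Nonempty (ι ⊕ κ ↪ Fin n) :=
    Function.Embedding.nonempty_of_card_le (by simpa using h)
  exact ⟨Function.partialInv e, fun c => ⟨e c, Function.partialInv_left e.injective c⟩⟩

/-- An algorithm that sends at most `L` bits succeeds at most as often as a two-party protocol on a
game that is realized by lines. -/
theorem TouchingLines.le_of_solvesWithProb {n k r L : ℕ} (hk : 2 ≤ k) {Ω : Type*}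
    [MeasurableSpace Ω] {μ : Measure Ω} [IsProbabilityMeasure μ]
    {π : LPCoordinatorProtocol 2 n k Ω} {B : ℤ} {ε δ : ℝ}
    (hπ : LPCoordinatorProtocol.SolvesWithProb π r μ B ε)
    (hcomm : ∀ (P : LinearProgram 2 n) (owner : Fin n → Fin k) (ω : Ω), P.Solvable →
      P.EntriesBounded B → LPCoordinatorProtocol.lpCommunication π r P owner ω ≤ L)
    {S T ι κ : Type} [Fintype S] [Fintype T] [Fintype ι] [Fintype κ] [Nonempty S] [Nonempty T]
    {ans : S → T → Bool} {P : S → ι → ℤ × ℤ} {Q : T → κ → ℤ × ℤ} {M R : ℤ}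
    (h : TouchingLines ans P Q M R)
    (hhard : HardGame {l : List Bool // l.length ≤ L} (2 * r) δ ans)
    (hn : Fintype.card ι + Fintype.card κ ≤ n) (hMB : M ≤ B) (hRB : 2 * M * R ≤ B) : ε ≤ δ := by
  classical
  obtain ⟨slot, hslot⟩ := exists_slot hn
  have hB1 : 1 ≤ B := h.one_le.trans hMB
  have hfeas : ∀ s y, ∃ x v : ℤ, decide (x % 2 = 1) = ans s y ∧
      ∀ z, (lineProgram slot (P s) (Q y)).Feasible z ↔ z = ![(x : ℝ), (v : ℝ)] := by
    intro s y
    obtain ⟨x, v, -, -, hans, hP, hQ, hpos, hneg⟩ := h.touch s y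
    exact ⟨x, v, hans, fun z => lineProgram_feasible_iff_eq hslot hP hQ hpos hneg⟩
  have hsol : ∀ s y, (lineProgram slot (P s) (Q y)).Solvable := fun s y => by
    obtain ⟨x, v, -, hf⟩ := hfeas s y
    exact ⟨_, (hf _).2 rfl, fun z hz => by rw [(hf z).1 hz]⟩
  have hbd : ∀ s y, (lineProgram slot (P s) (Q y)).EntriesBounded B := by
    refine fun s y => ⟨fun i => ?_, fun j => ?_⟩
    · fin_cases i
      · simpa [lineProgram] using by linarith
      · simpa [lineProgram] using hB1
    · rcases hj : slot j with _ | l | l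
      · simp only [lineProgram, hj]
        simp
        linarith
      · simp only [lineProgram, hj, Fin.forall_fin_two]
        simp
        exact ⟨⟨(h.bound_fst s l).1.trans hMB, hB1⟩, (h.bound_fst s l).2.trans hRB⟩
      · simp only [lineProgram, hj, Fin.forall_fin_two]
        simp
        exact ⟨⟨(h.bound_snd y l).1.trans hMB, hB1⟩, (h.bound_snd y l).2.trans hRB⟩
  set s₀ : Fin k := ⟨0, by omega⟩
  set s₁ : Fin k := ⟨1, by omega⟩
  have hs : s₀ ≠ s₁ := fun h => by simpa [s₀, s₁] using congrArg Fin.val h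
  set owner : Fin n → Fin k := fun j => match slot j with
    | some (Sum.inr _) => s₁
    | _ => s₀ with howner
  obtain ⟨F, hF, hle⟩ := exists_twoPartyComputable hπ (ans := ans) (owner := owner)
    (prog := fun s y => lineProgram slot (P s) (Q y))
    (dec := fun x => decide (∃ m : ℤ, x 0 = 2 * m + 1)) hs (z := ![0, 1]) (fun _ _ => rfl)
    (fun s s' y j hj => by
      rcases hj' : slot j with _ | l | l <;> simp [howner, lineProgram, hj'] at hj ⊢)
    (fun s y y' j hj => by
      rcases hj' : slot j with _ | l | l <;> simp [howner, lineProgram, hj'] at hj ⊢)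
    hsol hbd (fun s y z hz => by
      obtain ⟨x, v, hans, hf⟩ := hfeas s y
      rw [← hans, (hf z).1 hz.1, decide_eq_decide]
      simp only [Matrix.cons_val_zero]
      constructor
      · rintro ⟨m, hm⟩
        have : x = 2 * m + 1 := by exact_mod_cast hm
        omega
      · exact fun hx => ⟨x / 2, by exact_mod_cast (show x = 2 * (x / 2) + 1 by omega)⟩)
    (fun s y ω => hcomm _ owner ω (hsol s y) (hbd s y))
  refine hle.trans ?_
  have hu : ∀ (X : Type) [Fintype X], SubUniform 1 (fun _ : X => 1 / (Fintype.card X : ℝ)) id :=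
    fun X _ => ⟨fun _ => by positivity, fun x => by simp⟩
  exact hhard S T id id _ _ (hu S) (hu T) F hF

/-! ### The case without communication -/

/-- The linear program with the objective `y` in which all constraints are `y ≥ b`. -/
def halfPlaneProgram (n : ℕ) (b : Bool) : LinearProgram 2 n where
  obj := ![0, 1]
  con _ := (![0, -1], if b then -1 else 0)

theorem halfPlaneProgram_feasible_iff {n : ℕ} (hn : 1 ≤ n) {b : Bool} {x : Fin 2 → ℝ} :
    (halfPlaneProgram n b).Feasible x ↔ (if b then 1 else 0) ≤ x 1 := by
  constructor
  · intro h
    have := h ⟨0, hn⟩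
    cases b <;> simp [halfPlaneProgram] at this ⊢ <;> linarith
  · intro h j
    cases b <;> simp [halfPlaneProgram] at h ⊢ <;> linarith

theorem halfPlaneProgram_isOptimal_iff {n : ℕ} (hn : 1 ≤ n) {b : Bool} {x : Fin 2 → ℝ} :
    (halfPlaneProgram n b).IsOptimal x ↔ x 1 = if b then 1 else 0 := by
  have hval : ∀ z : Fin 2 → ℝ, (halfPlaneProgram n b).value z = z 1 := fun z => by
    simp [LinearProgram.value, halfPlaneProgram]
  simp only [LinearProgram.IsOptimal, halfPlaneProgram_feasible_iff hn, hval]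
  constructor
  · rintro ⟨h1, h2⟩
    exact le_antisymm (by simpa using h2 ![0, if b then 1 else 0] (by simp)) h1
  · exact fun h => ⟨h.ge, fun z hz => h ▸ hz⟩

/-- Without communication the success probability is at most `1 / 2`. -/
theorem le_half_of_no_communication {n k r : ℕ} (hn : 1 ≤ n) (hk : 2 ≤ k) {Ω : Type*}
    [MeasurableSpace Ω] {μ : Measure Ω} [IsProbabilityMeasure μ]
    {π : LPCoordinatorProtocol 2 n k Ω} {B : ℤ} (hB : 1 ≤ B) {ε : ℝ}
    (hπ : LPCoordinatorProtocol.SolvesWithProb π r μ B ε)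
    (hcomm : ∀ (P : LinearProgram 2 n) (owner : Fin n → Fin k) (ω : Ω), P.Solvable →
      P.EntriesBounded B → LPCoordinatorProtocol.lpCommunication π r P owner ω ≤ 0) :
    ε ≤ 1 / 2 := by
  classical
  have hsol : ∀ b, (halfPlaneProgram n b).Solvable := fun b =>
    ⟨![0, if b then 1 else 0], (halfPlaneProgram_isOptimal_iff hn).2 (by simp)⟩
  have hbd : ∀ b, (halfPlaneProgram n b).EntriesBounded B := by
    intro b
    have hB0 : 0 ≤ B := by linarith
    cases b <;> simp [LinearProgram.EntriesBounded, halfPlaneProgram, Fin.forall_fin_two, hB, hB0]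
  obtain ⟨F, hF, hle⟩ := exists_twoPartyComputable hπ (ans := fun (_ : Unit) b => b)
    (owner := fun _ => (⟨1, by omega⟩ : Fin k)) (s₀ := ⟨0, by omega⟩) (s₁ := ⟨1, by omega⟩)
    (prog := fun _ b => halfPlaneProgram n b) (dec := fun x => decide (x 1 = 1))
    (by simp) (z := ![0, 1]) (fun _ _ => rfl) (fun _ _ _ _ _ => rfl)
    (fun _ _ _ _ h => absurd rfl h) (fun _ => hsol) (fun _ => hbd)
    (fun _ b x hx => by
      rw [(halfPlaneProgram_isOptimal_iff hn).1 hx]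
      cases b <;> simp) (fun _ b ω => hcomm _ _ ω (hsol b) (hbd b))
  have : Subsingleton {l : List Bool // l.length ≤ 0} :=
    ⟨fun a b => Subtype.ext (by
      rw [List.eq_nil_of_length_eq_zero (Nat.le_zero.1 a.2),
        List.eq_nil_of_length_eq_zero (Nat.le_zero.1 b.2)])⟩
  obtain ⟨o, ho⟩ := hF.exists_const
  cases o <;> simpa [ho] using hle

/-! ### Choice of the parameters -/

/-- The condition `33 ≤ N` absorbs the bases 11 and 3 through `33 * N ^ 2 ≤ N ^ 3`. What remains is
`4 * (N ^ (2 * r)) ^ 3`, and `4` and `N ^ (2 * r)` are each at most `n`; this is the source of the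
exponent 4. -/
theorem entries_le_pow {N n r : ℕ} (hN : 33 ≤ N) (hr : 1 ≤ r) (hn : (2 * N) ^ (2 * r) ≤ n) :
    (11 * (N : ℤ)) ^ (2 * r) ≤ (n : ℤ) ^ 4 ∧
      2 * (11 * (N : ℤ)) ^ (2 * r) * (2 * (3 * (N : ℤ)) ^ (2 * r)) ≤ (n : ℤ) ^ 4 := by
  have h4 : 4 * N ^ (2 * r) ≤ n := by
    refine le_trans ?_ hn
    rw [mul_pow]
    gcongr
    calc 4 = 2 ^ 2 := rfl
      _ ≤ 2 ^ (2 * r) := Nat.pow_le_pow_right (by norm_num) (by omega)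
  have hN1 : 1 ≤ N ^ (2 * r) := Nat.one_le_pow _ _ (by omega)
  have key : 2 * (11 * N) ^ (2 * r) * (2 * (3 * N) ^ (2 * r)) ≤ n ^ 4 := by
    calc 2 * (11 * N) ^ (2 * r) * (2 * (3 * N) ^ (2 * r)) = 4 * (33 * N ^ 2) ^ (2 * r) := by
          rw [show 33 * N ^ 2 = 11 * N * (3 * N) by ring, mul_pow (11 * N)]
          ring
      _ ≤ 4 * (N ^ 3) ^ (2 * r) := by
          gcongr
          nlinarith [sq_nonneg N]
      _ = 4 * (N ^ (2 * r)) ^ 3 := by rw [← pow_mul, ← pow_mul, mul_comm 3]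
      _ ≤ n * n ^ 3 := by
          gcongr <;> omega
      _ = n ^ 4 := by ring
  refine ⟨?_, by exact_mod_cast key⟩
  have : (11 * N) ^ (2 * r) ≤ n ^ 4 := by
    refine le_trans ?_ key
    rw [mul_comm 2 ((11 * N) ^ (2 * r)), mul_assoc]
    exact Nat.le_mul_of_pos_right _ (by positivity)
  exact_mod_cast this

/-- If `L` bits suffice, then `N` is at most of the order of `r ^ 2 * (L + 1)`. -/
theorem lt_of_solvesWithProb {n k r L N : ℕ} (hr : 1 ≤ r) (hk : 2 ≤ k) (hN : 33 ≤ N)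
    (hn : (2 * N) ^ (2 * r) ≤ n) {Ω : Type*}
    [MeasurableSpace Ω] {μ : Measure Ω} [IsProbabilityMeasure μ]
    {π : LPCoordinatorProtocol 2 n k Ω}
    (hπ : LPCoordinatorProtocol.SolvesWithProb π r μ ((n : ℤ) ^ 4) (2 / 3))
    (hcomm : ∀ (P : LinearProgram 2 n) (owner : Fin n → Fin k) (ω : Ω), P.Solvable →
      P.EntriesBounded ((n : ℤ) ^ 4) → LPCoordinatorProtocol.lpCommunication π r P owner ω ≤ L) :
    (N : ℝ) < 800 * (r : ℝ) ^ 2 * (2 * L + 1) := by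
  have hr' : (1 : ℝ) ≤ r := by exact_mod_cast hr
  have hN' : (0 : ℝ) < N := by exact_mod_cast (by omega : 0 < N)
  -- Over `2 * r` messages the terms `lam` add up to `1/24`. Of the gap `1/6` between `1/2` and
  -- `2/3` this leaves `1/8` to be covered by the message terms.
  set lam : ℝ := 1 / (48 * r) with hlam
  have h0 : 0 < lam := by positivity
  have h1 : lam ≤ 1 := by
    rw [hlam, div_le_one (by positivity)]
    linarith
  obtain ⟨S, T, ι, κ, _, _, _, _, _, _, ans, P, Q, hH, hL, hι, hκ⟩ :=
    exists_hardGame_touchingLines {l : List Bool // l.length ≤ L} (by omega : 0 < N) h0 h1 (2 * r)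
  have hcard : Fintype.card ι + Fintype.card κ ≤ n := by
    refine le_trans ?_ hn
    rw [mul_pow]
    have : 2 ^ 2 ≤ 2 ^ (2 * r) := Nat.pow_le_pow_right (by norm_num) (by omega)
    have := Nat.mul_le_mul_right (N ^ (2 * r)) this
    omega
  have hle := hL.le_of_solvesWithProb hk hπ hcomm hH hcard (entries_le_pow hN hr hn).1
    (entries_le_pow hN hr hn).2
  have hlog := log_card_boundedMessage_le L
  set ℓ := Real.log (Fintype.card {l : List Bool // l.length ≤ L})
  have e : ((2 * r : ℕ) : ℝ) * (lam + (ℓ + 1) / (lam * N)) =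
      1 / 24 + 96 * (r : ℝ) ^ 2 * (ℓ + 1) / N := by
    rw [hlam]
    push_cast
    field_simp
    ring
  rw [e] at hle
  have h2 : 1 / 8 ≤ 96 * (r : ℝ) ^ 2 * (ℓ + 1) / N := by linarith
  rw [le_div_iff₀ hN'] at h2
  have h3 : (r : ℝ) ^ 2 * (ℓ + 1) ≤ (r : ℝ) ^ 2 * (2 * L + 1) := by gcongr
  have h4 : 0 < (r : ℝ) ^ 2 * (2 * L + 1) := by positivity
  linarith

/-- There are universal constants `K` and `c > 0` such that every `r`-round randomized algorithm
in the coordinator model with `k ≥ 2` sites that finds, with probability at least `2/3`, an optimal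
solution of every `2`-dimensional linear program with `n` constraints and integer entries of
absolute value at most `n ^ K` (numbers of `O(log n)` bits) has worst-case communication at least
`c * n ^ (1 / (2 r)) / r ^ 2`. -/
theorem mainTheorem4 :
    ∃ (K : ℕ) (c : ℝ), 0 < c ∧
      ∀ (r n k : ℕ), 1 ≤ r → 1 ≤ n → 2 ≤ k →
      ∀ (Ω : Type*) [MeasurableSpace Ω] (μ : Measure Ω) [IsProbabilityMeasure μ]
        (π : LPCoordinatorProtocol 2 n k Ω),
        LPCoordinatorProtocol.SolvesWithProb π r μ ((n : ℤ) ^ K) (2 / 3) →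
        ∃ (P : LinearProgram 2 n) (owner : Fin n → Fin k) (ω : Ω),
          P.Solvable ∧ P.EntriesBounded ((n : ℤ) ^ K) ∧
          c * ((n : ℝ) ^ (1 / (2 * (r : ℝ))) / (r : ℝ) ^ 2) ≤
            (LPCoordinatorProtocol.lpCommunication π r P owner ω : ℝ) := by
  refine ⟨4, 1 / 10000, by norm_num, ?_⟩
  intro r n k hr hn hk Ω _ μ _ π hπ
  by_contra! hcon
  set v : ℝ := (n : ℝ) ^ (1 / (2 * (r : ℝ))) with hv
  have hr' : (1 : ℝ) ≤ r := by exact_mod_cast hr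
  have hv0 : 0 ≤ v := by positivity
  set b : ℝ := 1 / 10000 * (v / (r : ℝ) ^ 2) with hb
  have hb0 : 0 ≤ b := by positivity
  have hvb : v = 10000 * (r : ℝ) ^ 2 * b := by
    rw [hb]
    field_simp
  -- If `b ≤ 1`, only a single bit has to be forced, and `n` may be too small for the line games.
  -- Otherwise `v ≥ 10000`, which makes `N` at least 33.
  rcases le_or_gt b 1 with hb1 | hb1
  · have := le_half_of_no_communication hn hk (one_le_pow₀ (by exact_mod_cast hn)) hπ
      fun P owner ω hP hPB => by
        have := (hcon P owner ω hP hPB).trans_le hb1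
        have : LPCoordinatorProtocol.lpCommunication π r P owner ω < 1 := by exact_mod_cast this
        omega
    norm_num at this
  · have hv1 : 10000 * (r : ℝ) ^ 2 ≤ v := by
      rw [hvb]
      exact le_mul_of_one_le_right (by positivity) hb1.le
    have hr2 : (1 : ℝ) ≤ (r : ℝ) ^ 2 := one_le_pow₀ hr'
    set N := ⌊v / 2⌋₊ with hN
    have hNle : (N : ℝ) ≤ v / 2 := Nat.floor_le (by positivity)
    have hNlt : v / 2 < N + 1 := Nat.lt_floor_add_one _
    have hN33 : 33 ≤ N := Nat.le_floor (by push_cast; linarith)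
    have hpow : (2 * N) ^ (2 * r) ≤ n := by
      have h1 : (2 * (N : ℝ)) ^ (2 * r) ≤ v ^ (2 * r) := by
        gcongr
        linarith
      have h2 : v ^ (2 * r) = n := by
        rw [hv, ← Real.rpow_natCast, ← Real.rpow_mul (by positivity)]
        push_cast
        rw [one_div_mul_cancel (by positivity), Real.rpow_one]
      rw [h2] at h1
      exact_mod_cast h1
    have hlt := lt_of_solvesWithProb (L := ⌊b⌋₊) hr hk hN33 hpow hπ
      fun P owner ω hP hPB => Nat.le_floor (hcon P owner ω hP hPB).le
    have hL : (⌊b⌋₊ : ℝ) ≤ b := Nat.floor_le hb0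
    -- Since `b > 1`, this gives `N < 2400 * r ^ 2 * b`, whereas `N > v / 2 - 1 = 5000 * r ^ 2 * b -
    -- 1`.
    have h3 : 800 * (r : ℝ) ^ 2 * (2 * (⌊b⌋₊ : ℝ) + 1) ≤ 800 * (r : ℝ) ^ 2 * (3 * b) := by
      gcongr
      linarith
    linarith
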